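/- Let $\alpha,\beta\in\mathbb C\setminus\{0\}$ with $\alpha\neq\beta$ and $|\alpha|=|\beta|\neq 1$, and let $H_{\alpha,\beta}=(\mathbb C^2\setminus\{0\})/\langle\gamma\rangle$, $\gamma(z_1,z_2)=(\alpha z_1,\beta z_2)$, be the corresponding diagonal Hopf surface. A Hermitian metric $g$ with fundamental form $\omega$ is called Vaisman if there is a closed $1$-form $\theta$ (the Lee form) with $d\omega=\theta\wedge\omega$ which is parallel for the Levi-Civita connection of $g$. For $N\le\infty$ and $\lambda\in\mathbb C\setminus\{0\}$ with $|\lambda|\ne1$, let $H^N_\lambda=(\mathbb C^N\setminus\{0\})/\langle\lambda\cdot\mathrm{id}\rangle$ be the classical Hopf manifold (with $\ell^2(\mathbb C)$ in place of $\mathbb C^N$ if $N=\infty$), with the metric $\omega_H=\|z\|^{-2}\omega_0$, where $\omega_0=dd^c\|z\|^2$ is the form of the flat metric and $dd^c=\frac{\sqrt{-1}}{2}\partial\bar\partial$. A Hermitian metric $\omega$ on a complex manifold $M$ is called Hopf-induced if there are such $N$ and $\lambda$ and a holomorphic map $f\colon M\to H^N_\lambda$ with $f^*\omega_H=\omega$.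 Then the following hold. 1. The Gauduchon--Ornea metric on $H_{\alpha,\beta}$, that is, the metric whose pull-back to $\mathbb C^2\setminus\{0\}$ has fundamental form $\Phi^{-1}dd^c\Phi$, where $\Phi>0$ is the solution of $$|z_1|^2\,\Phi^{-\frac{2\log|\alpha|}{\log|\alpha|+\log|\beta|}}+|z_2|^2\,\Phi^{-\frac{2\log|\beta|}{\log|\alpha|+\log|\beta|}}=1,$$ exists and is a Vaisman metric. 2. No Vaisman metric on $H_{\alpha,\beta}$ (in particular, not the Gauduchon--Ornea metric) can be approximated by Hopf-induced metrics: for every $k\in\{0,1,2,\dots,\infty\}$, no sequence of Hopf-induced metrics on $H_{\alpha,\beta}$ converges to it in the $\mathcal C^k$-topology. In particular, it is not true in general that Vaisman metrics can be approximated by Hopf-induced metrics, so the analogue for locally conformally Kähler metrics of Tian's approximation theorem fails. -/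

import Mathlib

open scoped ContDiff

set_option maxSynthPendingDepth 3

noncomputable section

namespace HopfLcK

/-! ### Linear Hopf manifolds -/

section Hopf

variable {E : Type*} [NormedAddCommGroup E] [NormedSpace ℂ E]

/-- The orbit relation on `E \ {0}` of the infinite cyclic group generated by the linear
automorphism `A`. -/
def hopfSetoid (A : E ≃L[ℂ] E) : Setoid {z : E // z ≠ 0} where
  r z w := ∃ n : ℤ, (A ^ n) (z : E) = w
  iseqv :=
    { refl := fun _ => ⟨0, by rw [zpow_zero]; rfl⟩
      symm := by
        rintro z w ⟨n, hn⟩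
        refine ⟨-n, ?_⟩
        have h : (A ^ (-n) * A ^ n) (z : E) = z := by
          rw [← zpow_add, neg_add_cancel, zpow_zero]; rfl
        rw [← hn]; exact h
      trans := by
        rintro z w v ⟨n, hn⟩ ⟨m, hm⟩
        refine ⟨m + n, ?_⟩
        rw [zpow_add, ← hm, ← hn]; rfl }

/-- The linear Hopf manifold `(E \ {0}) / ⟨A⟩`. -/
def HopfManifold (A : E ≃L[ℂ] E) : Type _ := Quotient (hopfSetoid A)

/-- The covering projection `E \ {0} → (E \ {0}) / ⟨A⟩`. -/
def HopfManifold.proj (A : E ≃L[ℂ] E) (z : E) (hz : z ≠ 0) : HopfManifold A :=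
  Quotient.mk (hopfSetoid A) ⟨z, hz⟩

/-- The automorphism `λ · id`. -/
def scalarAut (E : Type*) [NormedAddCommGroup E] [NormedSpace ℂ E] (lam : ℂˣ) : E ≃L[ℂ] E :=
  ContinuousLinearEquiv.smulLeft lam

/-- A (smooth) Hermitian metric on `(E \ {0}) / ⟨A⟩`, given as the Riemannian metric
`z ↦ toFun z` on the covering `E \ {0}`, compatible with multiplication by `i` and invariant
under the deck transformation `A` (whose differential is `A`). The value at `z = 0` is
irrelevant. -/
structure HermitianMetric (A : E ≃L[ℂ] E) where
  toFun : E → E →L[ℝ] E →L[ℝ] ℝ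
  smooth : ContDiffOn ℝ ∞ toFun {0}ᶜ
  symm : ∀ z, z ≠ 0 → ∀ X Y : E, toFun z X Y = toFun z Y X
  pos : ∀ z, z ≠ 0 → ∀ X : E, X ≠ 0 → 0 < toFun z X X
  map_I : ∀ z, z ≠ 0 → ∀ X Y : E, toFun z (Complex.I • X) (Complex.I • Y) = toFun z X Y
  invariant : ∀ z, z ≠ 0 → ∀ X Y : E, toFun (A z) (A X) (A Y) = toFun z X Y

/-! ### lcK and Vaisman metrics -/

/-- The fundamental form `ω(X, Y) = g(iX, Y)`, as a function of the point. -/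
def fundForm {A : E ≃L[ℂ] E} (g : HermitianMetric A) (X Y : E) (z : E) : ℝ :=
  g.toFun z (Complex.I • X) Y

/-- `θ` is the Lee form of `g`: a smooth closed 1-form on `(E \ {0}) / ⟨A⟩` (given by its
pull-back to `E \ {0}`) with `dω = θ ∧ ω`. -/
structure IsLeeForm {A : E ≃L[ℂ] E} (g : HermitianMetric A) (θ : E → E →L[ℝ] ℝ) : Prop where
  smooth : ContDiffOn ℝ ∞ θ {0}ᶜ
  invariant : ∀ z, z ≠ 0 → ∀ X : E, θ (A z) (A X) = θ z X
  closed : ∀ z, z ≠ 0 → ∀ X Y : E, fderiv ℝ θ z X Y - fderiv ℝ θ z Y X = 0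
  lck : ∀ z, z ≠ 0 → ∀ X Y Z : E,
    fderiv ℝ (fundForm g Y Z) z X - fderiv ℝ (fundForm g X Z) z Y
        + fderiv ℝ (fundForm g X Y) z Z
      = θ z X * fundForm g Y Z z - θ z Y * fundForm g X Z z + θ z Z * fundForm g X Y z

/-- `V` is the value at `z` of `∇_X Y`, for the Levi-Civita connection `∇` of `g` and the
constant vector fields `X`, `Y` (Koszul formula). -/
def IsLeviCivita {A : E ≃L[ℂ] E} (g : HermitianMetric A) (z X Y V : E) : Prop :=
  ∀ Z : E, 2 * g.toFun z V Z =
    fderiv ℝ g.toFun z X Y Z + fderiv ℝ g.toFun z Y X Z - fderiv ℝ g.toFun z Z X Y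

/-- The 1-form `θ` is parallel for the Levi-Civita connection:
`(∇_X θ)(Y) = X(θ(Y)) - θ(∇_X Y) = 0`. -/
def IsParallel {A : E ≃L[ℂ] E} (g : HermitianMetric A) (θ : E → E →L[ℝ] ℝ) : Prop :=
  ∀ z, z ≠ 0 → ∀ X Y : E, ∃ V : E, IsLeviCivita g z X Y V ∧ fderiv ℝ θ z X Y - θ z V = 0

/-- A Vaisman metric: an lcK metric whose Lee form is parallel. -/
def IsVaisman {A : E ≃L[ℂ] E} (g : HermitianMetric A) : Prop :=
  ∃ θ : E → E →L[ℝ] ℝ, IsLeeForm g θ ∧ IsParallel g θ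

/-! ### Convergence of metrics -/

/-- `g m → g` in the `C^k`-topology (`k ≤ ∞`): on each compact subset of the covering, the
derivatives of order at most `k` of the coefficients converge uniformly. -/
def TendstoCk {A : E ≃L[ℂ] E} (k : ℕ∞) (gs : ℕ → HermitianMetric A) (g : HermitianMetric A) :
    Prop :=
  ∀ j : ℕ, (j : ℕ∞) ≤ k → ∀ K : Set E, IsCompact K → K ⊆ {0}ᶜ →
    TendstoUniformlyOn (fun m => iteratedFDeriv ℝ j (gs m).toFun)
      (iteratedFDeriv ℝ j g.toFun) Filter.atTop K

/-! ### Holomorphic maps and pull-back of metrics -/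

variable {V : Type*} [NormedAddCommGroup V] [NormedSpace ℂ V]

/-- `F` is a holomorphic local lift of `f`, on the open subset `U` of `E \ {0}`. -/
structure IsLocalLift {A : E ≃L[ℂ] E} {B : V ≃L[ℂ] V} (f : HopfManifold A → HopfManifold B)
    (U : Set E) (F : E → V) : Prop where
  isOpen : IsOpen U
  differentiableOn : DifferentiableOn ℂ F U
  lift : ∀ z ∈ U, ∃ (hz : z ≠ 0) (hF : F z ≠ 0),
    f (HopfManifold.proj A z hz) = HopfManifold.proj B (F z) hF

/-- `f` is holomorphic for the quotient complex structures. -/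
def IsHolomorphic {A : E ≃L[ℂ] E} {B : V ≃L[ℂ] V} (f : HopfManifold A → HopfManifold B) : Prop :=
  ∀ z : E, z ≠ 0 → ∃ (U : Set E) (F : E → V), z ∈ U ∧ IsLocalLift f U F

/-- `f^* h = g`. -/
def IsPullback {A : E ≃L[ℂ] E} {B : V ≃L[ℂ] V} (f : HopfManifold A → HopfManifold B)
    (h : HermitianMetric B) (g : HermitianMetric A) : Prop :=
  ∀ (U : Set E) (F : E → V), IsLocalLift f U F → ∀ z ∈ U, ∀ X Y : E,
    g.toFun z X Y = h.toFun (F z) (fderiv ℂ F z X) (fderiv ℂ F z Y)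

end Hopf

/-! ### Classical Hopf manifolds and Hopf-induced metrics -/

section Classical

/-- The flat metric `g₀(X, Y) = Re ⟪X, Y⟫` of a complex inner product space. -/
def flatMetric (V : Type*) [NormedAddCommGroup V] [InnerProductSpace ℂ V] : V →L[ℝ] V →L[ℝ] ℝ :=
  LinearMap.mkContinuous₂
    (LinearMap.mk₂ ℝ (fun X Y : V => (inner ℂ X Y).re)
      (fun X X' Y => by simp)
      (fun c X Y => by
        rw [← Complex.coe_smul, inner_smul_left]; simp)
      (fun X Y Y' => by simp)
      (fun c X Y => by
        rw [← Complex.coe_smul, inner_smul_right]; simp))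
    1
    (fun X Y => by
      simpa using (Complex.abs_re_le_norm _).trans (norm_inner_le_norm (𝕜 := ℂ) X Y))

theorem flatMetric_apply {V : Type*} [NormedAddCommGroup V] [InnerProductSpace ℂ V] (X Y : V) :
    flatMetric V X Y = (inner ℂ X Y).re := rfl

/-- The metric `‖z‖⁻² g₀` on the classical Hopf manifold `(V \ {0}) / ⟨λ · id⟩`. -/
def classicalHopfMetric (V : Type*) [NormedAddCommGroup V] [InnerProductSpace ℂ V] (lam : ℂˣ) :
    HermitianMetric (scalarAut V lam) where
  toFun z := (‖z‖ ^ 2)⁻¹ • flatMetric V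
  smooth := by
    have h1 : ContDiffOn ℝ ∞ (fun z : V => ‖z‖ ^ 2) {0}ᶜ := by
      let _ : InnerProductSpace ℝ V := InnerProductSpace.rclikeToReal ℂ V
      exact (contDiff_norm_sq ℝ (E := V) (n := ∞)).contDiffOn
    have h2 : ContDiffOn ℝ ∞ (fun z : V => (‖z‖ ^ 2)⁻¹) {0}ᶜ := by
      refine h1.inv fun z hz => ?_
      have : z ≠ 0 := hz
      simpa using this
    exact h2.smul contDiffOn_const
  symm z _ X Y := by
    change (‖z‖ ^ 2)⁻¹ * (inner ℂ X Y).re = (‖z‖ ^ 2)⁻¹ * (inner ℂ Y X).re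
    rw [← inner_conj_symm X Y, Complex.conj_re]
  pos z hz X hX := by
    change 0 < (‖z‖ ^ 2)⁻¹ * (inner ℂ X X).re
    have h2 : (inner ℂ X X).re = ‖X‖ ^ 2 := by
      rw [inner_self_eq_norm_sq_to_K]; norm_cast
    rw [h2]
    positivity
  map_I z _ X Y := by
    change (‖z‖ ^ 2)⁻¹ * (inner ℂ (Complex.I • X) (Complex.I • Y)).re
      = (‖z‖ ^ 2)⁻¹ * (inner ℂ X Y).re
    simp [← mul_assoc]
  invariant z hz X Y := by
    have hl : ‖(lam : ℂ)‖ ≠ 0 := by simp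
    have hz' : ‖z‖ ≠ 0 := by simpa using hz
    change (‖(lam : ℂ) • z‖ ^ 2)⁻¹ * (inner ℂ ((lam : ℂ) • X) ((lam : ℂ) • Y)).re
      = (‖z‖ ^ 2)⁻¹ * (inner ℂ X Y).re
    have hin : (inner ℂ ((lam : ℂ) • X) ((lam : ℂ) • Y)).re
        = ‖(lam : ℂ)‖ ^ 2 * (inner ℂ X Y).re := by
      rw [inner_smul_left, inner_smul_right, ← mul_assoc, Complex.conj_mul', ← Complex.ofReal_pow,
        Complex.re_ofReal_mul]
    rw [hin, norm_smul]
    field_simp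

/-- The Hermitian metric `g` is induced by a holomorphic map into the classical Hopf manifold
`(V \ {0}) / ⟨λ · id⟩`. -/
def IsInducedBy {E : Type*} [NormedAddCommGroup E] [NormedSpace ℂ E] {A : E ≃L[ℂ] E}
    (V : Type*) [NormedAddCommGroup V] [InnerProductSpace ℂ V] (lam : ℂˣ)
    (g : HermitianMetric A) : Prop :=
  ∃ f : HopfManifold A → HopfManifold (scalarAut V lam),
    IsHolomorphic f ∧ IsPullback f (classicalHopfMetric V lam) g

/-- Hopf-induced metrics: those induced by a holomorphic map into an `N`-dimensional classical
Hopf manifold, where `N ≤ ∞` and the model space for `N = ∞` is `ℓ²(ℂ)`. -/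
def IsHopfInduced {E : Type*} [NormedAddCommGroup E] [NormedSpace ℂ E] {A : E ≃L[ℂ] E}
    (g : HermitianMetric A) : Prop :=
  ∃ lam : ℂˣ, ‖(lam : ℂ)‖ ≠ 1 ∧
    ((∃ N : ℕ, IsInducedBy (EuclideanSpace ℂ (Fin N)) lam g) ∨
      IsInducedBy (lp (fun _ : ℕ => ℂ) 2) lam g)

/-- `g` can be approximated by Hopf-induced metrics in the `C^k`-topology. -/
def IsApproximable {E : Type*} [NormedAddCommGroup E] [NormedSpace ℂ E] {A : E ≃L[ℂ] E}
    (k : ℕ∞) (g : HermitianMetric A) : Prop :=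
  ∃ gs : ℕ → HermitianMetric A, (∀ m, IsHopfInduced (gs m)) ∧ TendstoCk k gs g

end Classical

/-! ### Diagonal Hopf surfaces -/

section Surfaces

/-- The automorphism `(z₁, z₂) ↦ (α z₁, β z₂)` of `ℂ²`; the diagonal Hopf surface is
`HopfManifold (diagAut α β)`. -/
def diagAut (α β : ℂˣ) : EuclideanSpace ℂ (Fin 2) ≃L[ℂ] EuclideanSpace ℂ (Fin 2) :=
  LinearEquiv.toContinuousLinearEquiv
    { toFun := fun z => !₂[(α : ℂ) * z 0, (β : ℂ) * z 1]
      invFun := fun z => !₂[(α : ℂ)⁻¹ * z 0, (β : ℂ)⁻¹ * z 1]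
      map_add' := by intro z w; ext i; fin_cases i <;> simp [mul_add]
      map_smul' := by intro c z; ext i; fin_cases i <;> simp <;> ring
      left_inv := by intro z; ext i; fin_cases i <;> simp
      right_inv := by intro z; ext i; fin_cases i <;> simp }

/-- The Gauduchon-Ornea potential: the positive function `Φ` on `ℂ² \ {0}` with
`|z₁|² Φ^(-2 log|α| / (log|α| + log|β|)) + |z₂|² Φ^(-2 log|β| / (log|α| + log|β|)) = 1`. -/
def IsGauduchonOrneaPotential (α β : ℂˣ) (Φ : EuclideanSpace ℂ (Fin 2) → ℝ) : Prop :=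
  ∀ z, z ≠ 0 → 0 < Φ z ∧
    ‖z 0‖ ^ 2 * Φ z ^ (-(2 * Real.log ‖(α : ℂ)‖
        / (Real.log ‖(α : ℂ)‖ + Real.log ‖(β : ℂ)‖)))
      + ‖z 1‖ ^ 2 * Φ z ^ (-(2 * Real.log ‖(β : ℂ)‖
        / (Real.log ‖(α : ℂ)‖ + Real.log ‖(β : ℂ)‖))) = 1

/-- The symmetric tensor with associated `(1,1)`-form `dd^c Φ = (i/2) ∂∂̄ Φ`; for `Φ = ‖z‖²` it
is the flat metric `Re ⟪X, Y⟫`. -/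
def ddcTensor {E : Type*} [NormedAddCommGroup E] [NormedSpace ℂ E] (Φ : E → ℝ) (z X Y : E) : ℝ :=
  (1 / 4) * (fderiv ℝ (fderiv ℝ Φ) z X Y
    + fderiv ℝ (fderiv ℝ Φ) z (Complex.I • X) (Complex.I • Y))

/-- `g` is the Gauduchon-Ornea metric, with associated form `Φ⁻¹ dd^c Φ`, where `Φ` is the
Gauduchon-Ornea potential. -/
def IsGauduchonOrnea (α β : ℂˣ) (g : HermitianMetric (diagAut α β)) : Prop :=
  ∃ Φ : EuclideanSpace ℂ (Fin 2) → ℝ, IsGauduchonOrneaPotential α β Φ ∧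
    ∀ z, z ≠ 0 → ∀ X Y, g.toFun z X Y = (Φ z)⁻¹ * ddcTensor Φ z X Y

end Surfaces

end HopfLcK

end

/-! When `|α| = |β|`, both exponents in the Gauduchon–Ornea equation are `-1`, so `Φ = ‖z‖²`. The
metric is `‖z‖⁻² g₀`, and it is Vaisman by explicit computation. For the negative part, a
Hopf-induced metric does not exist at all. Let `F` be a local lift of a holomorphic `f` along the
curve `z₂ = 0`, uniformised by `u ↦ (e^u, 0)`, and put `G(u) = F(e^u, 0)`, `H(u) = ∂F/∂z₂ (e^u, 0)`.
With `e^a = α`, both are quasi-periodic under `a` and `2πi`: the multipliers of `G` are `λ^k`,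
`λ^l`, those of `H` are `λ^k β⁻¹`, `λ^l`. By Liouville (`exists_eq_exp_smul_of_quasiperiodic`) both
are exponentials, and if `H 0 ≠ 0` comparing exponents gives `α^n = β` for an integer `n`. Absolute
values force `n = 1`, against `α ≠ β`. So `dF` kills a vector (`exists_localLift_fderiv_eq_zero`),
and the pull-back is not positive definite. -/

noncomputable section

namespace HopfLcK

open Filter Topology Metric

/-! ### Vector-valued holomorphic functions: transverse derivatives and quasi-periodicity. -/

section ComplexAnalysis

variable {V : Type*} [NormedAddCommGroup V] [NormedSpace ℂ V]

/-- A second order Schwarz estimate: the first Taylor remainder of a holomorphic function bounded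
by `M` on the disc of radius `R`. -/
theorem norm_taylor_remainder_le {φ : ℂ → V} {R M : ℝ} (hR : 0 < R)
    (hφ : DifferentiableOn ℂ φ (ball 0 R)) (hM : ∀ w ∈ ball (0 : ℂ) R, ‖φ w‖ ≤ M)
    {w : ℂ} (hw : w ∈ ball (0 : ℂ) R) :
    ‖φ w - φ 0 - w • deriv φ 0‖ ≤ (4 * M) * (‖w‖ / R) ^ 2 := by
  have h0 : (0 : ℂ) ∈ ball (0 : ℂ) R := mem_ball_self hR
  have hd0 : DifferentiableAt ℂ φ 0 := hφ.differentiableAt (ball_mem_nhds _ hR)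
  have hdb : ‖deriv φ 0‖ ≤ 2 * M / R := by
    refine Complex.norm_deriv_le_div_of_mapsTo_ball hφ (fun z hz => ?_) hR
    rw [mem_closedBall, dist_eq_norm]
    linarith [norm_sub_le (φ z) (φ 0), hM z hz, hM 0 h0]
  -- The remainder is `o(w)` at `0`, hence the power `n + 1 = 2`. It is bounded by `4M`: `2M` for `φ
  -- w - φ 0` and `R * (2M / R)` for the linear term.
  have key := Complex.dist_le_mul_div_pow_of_mapsTo_ball_of_isLittleO (n := 1) (R₁ := R)
    (R₂ := 4 * M) (c := 0) (z := w) (f := fun w => φ w - φ 0 - w • deriv φ 0)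
    ((hφ.sub_const _).sub (differentiableOn_id.smul_const _)) (fun z hz => ?_) ?_ hw
  · simpa [dist_eq_norm] using key
  · have hz' : ‖z‖ ≤ R := by simpa using (mem_ball_zero_iff.1 hz).le
    have h1 : ‖z • deriv φ 0‖ ≤ 2 * M := by
      rw [norm_smul]
      calc ‖z‖ * ‖deriv φ 0‖ ≤ R * (2 * M / R) := by gcongr
        _ = 2 * M := by field_simp
    simp only [mem_closedBall, dist_eq_norm, sub_self, zero_smul, sub_zero]
    linarith [norm_sub_le (φ z - φ 0) (z • deriv φ 0), norm_sub_le (φ z) (φ 0), hM z hz, hM 0 h0]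
  · have := (hasDerivAt_iff_isLittleO.1 hd0.hasDerivAt).norm_right
    simpa using this

/-- A partial derivative of a holomorphic function of two variables is holomorphic along the
complementary axis. -/
theorem differentiableAt_deriv_snd [CompleteSpace V] {Ψ : ℂ × ℂ → V} {u₀ : ℂ}
    (hΨ : ∀ᶠ x in 𝓝 (u₀, (0 : ℂ)), DifferentiableAt ℂ Ψ x) :
    DifferentiableAt ℂ (fun u => deriv (fun w => Ψ (u, w)) 0) u₀ := by
  have hc : ∀ᶠ x in 𝓝 (u₀, (0 : ℂ)), ‖Ψ x‖ ≤ ‖Ψ (u₀, 0)‖ + 1 := by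
    have := hΨ.self_of_nhds.continuousAt.norm
    exact (this.eventually_lt_const (lt_add_one _)).mono fun _ h => h.le
  obtain ⟨R, hR, hball⟩ := Metric.eventually_nhds_iff_ball.1 (hΨ.and hc)
  set M := ‖Ψ (u₀, 0)‖ + 1
  have hmem : ∀ u ∈ ball u₀ R, ∀ w ∈ ball (0 : ℂ) R, (u, w) ∈ ball (u₀, (0 : ℂ)) R := by
    intro u hu w hw
    rw [← ball_prod_same]
    exact ⟨hu, hw⟩
  -- The shift by `2` keeps every step strictly inside the disc of radius `R`, including at `n = 0`.
  have hw : Tendsto (fun n : ℕ => ((R / (n + 2) : ℝ) : ℂ)) atTop (𝓝 0) := by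
    have h : Tendsto (fun n : ℕ => R / ((n : ℝ) + 2)) atTop (𝓝 0) :=
      tendsto_const_nhds.div_atTop (tendsto_atTop_add_const_right _ _ tendsto_natCast_atTop_atTop)
    simpa only [Complex.ofReal_zero, Function.comp_def] using
      (Complex.continuous_ofReal.tendsto 0).comp h
  set x : ℕ → ℂ := fun n => ((R / (n + 2) : ℝ) : ℂ)
  have hx : ∀ n, x n ∈ ball (0 : ℂ) R := by
    intro n
    rw [mem_ball_zero_iff, Complex.norm_real, Real.norm_of_nonneg (by positivity)]
    rw [div_lt_iff₀ (by positivity)]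
    nlinarith [(n.cast_nonneg : (0 : ℝ) ≤ n)]
  have hx0 : ∀ n, x n ≠ 0 := by
    intro n
    have : (R / ((n : ℝ) + 2)) ≠ 0 := by positivity
    exact Complex.ofReal_ne_zero.2 this
  -- Difference quotients in `w` are holomorphic in `u`; the quadratic remainder bound has constants
  -- independent of `u`, so they converge uniformly.
  have hlim : TendstoUniformlyOn (fun n u => (x n)⁻¹ • (Ψ (u, x n) - Ψ (u, 0)))
      (fun u => deriv (fun w => Ψ (u, w)) 0) atTop (ball u₀ R) := by
    rw [Metric.tendstoUniformlyOn_iff]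
    intro ε hε
    have hb : Tendsto (fun n => 4 * M / R ^ 2 * ‖x n‖) atTop (𝓝 0) := by
      simpa using hw.norm.const_mul (4 * M / R ^ 2)
    filter_upwards [hb.eventually_lt_const hε] with n hn u hu
    have h := norm_taylor_remainder_le (φ := fun w => Ψ (u, w)) (M := M) hR
      (fun w hw => ((hball _ (hmem u hu w hw)).1.comp w (by fun_prop)).differentiableWithinAt)
      (fun w hw => (hball _ (hmem u hu w hw)).2) (hx n)
    refine lt_of_le_of_lt ?_ hn
    have hpos : 0 < ‖x n‖ := norm_pos_iff.2 (hx0 n)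
    have e : (x n)⁻¹ • (Ψ (u, x n) - Ψ (u, 0)) - deriv (fun w => Ψ (u, w)) 0
        = (x n)⁻¹ • (Ψ (u, x n) - Ψ (u, 0) - x n • deriv (fun w => Ψ (u, w)) 0) := by
      rw [smul_sub (x n)⁻¹ (Ψ (u, x n) - Ψ (u, 0)), smul_smul, inv_mul_cancel₀ (hx0 n), one_smul]
    rw [dist_comm, dist_eq_norm, e, norm_smul, norm_inv]
    calc ‖x n‖⁻¹ * _ ≤ ‖x n‖⁻¹ * ((4 * M) * (‖x n‖ / R) ^ 2) := by gcongr
      _ = 4 * M / R ^ 2 * ‖x n‖ := by field_simp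
  refine (hlim.tendstoLocallyUniformlyOn.differentiableOn (Eventually.of_forall fun n u hu => ?_)
    isOpen_ball).differentiableAt (ball_mem_nhds _ hR)
  refine (DifferentiableAt.const_smul (DifferentiableAt.sub ?_ ?_) _).differentiableWithinAt
  · exact DifferentiableAt.comp (f := fun u => (u, x n)) u (hball _ (hmem u hu _ (hx n))).1
      (by fun_prop)
  · exact DifferentiableAt.comp (f := fun u => (u, (0 : ℂ))) u
      (hball _ (hmem u hu _ (mem_ball_self hR))).1 (by fun_prop)

/-- An entire function which is multiplicatively quasi-periodic for the periods `a` and `2πi` is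
an exponential. -/
theorem exists_eq_exp_smul_of_quasiperiodic {G : ℂ → V} (hG : Differentiable ℂ G) {a μ ν : ℂ}
    (ha : a.re ≠ 0) (hμ : μ ≠ 0) (hν : ν ≠ 0) (h1 : ∀ u, G (u + a) = μ • G u)
    (h2 : ∀ u, G (u + 2 * Real.pi * Complex.I) = ν • G u) :
    ∃ c : ℂ, ∀ u, G u = Complex.exp (c * u) • G 0 := by
  -- Two real linear equations: the period `2πi` fixes `Im c`, and then `a.re ≠ 0` allows solving
  -- for `Re c`. With this `c`, the norm of `e^{-cu} G(u)` is doubly periodic.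
  obtain ⟨c, hc1, hc2⟩ : ∃ c : ℂ, (c * a).re = Real.log ‖μ‖ ∧
      (c * (2 * Real.pi * Complex.I)).re = Real.log ‖ν‖ := by
    refine ⟨⟨(Real.log ‖μ‖ - Real.log ‖ν‖ / (2 * Real.pi) * a.im) / a.re,
      -(Real.log ‖ν‖ / (2 * Real.pi))⟩, ?_, ?_⟩
    · simp only [Complex.mul_re]
      field_simp
      simp
    · simp
  set N : ℂ → ℝ := fun u => ‖Complex.exp (-(c * u)) • G u‖ with hN
  have hper : ∀ (b ρ : ℂ), ρ ≠ 0 → (∀ u, G (u + b) = ρ • G u) → (c * b).re = Real.log ‖ρ‖ →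
      Function.Periodic N b := by
    intro b ρ hρ hb hcb u
    have : ‖Complex.exp (-(c * b))‖ * ‖ρ‖ = 1 := by
      rw [Complex.norm_exp, Complex.neg_re, hcb, Real.exp_neg, Real.exp_log (norm_pos_iff.2 hρ),
        inv_mul_cancel₀ (norm_ne_zero_iff.2 hρ)]
    simp only [hN]
    rw [hb, mul_add, neg_add, Complex.exp_add, smul_smul, norm_smul, norm_smul, norm_mul, norm_mul]
    linear_combination ‖Complex.exp (-(c * u))‖ * ‖G u‖ * this
  have hpa := hper a μ hμ h1 hc1
  have hpb := hper _ ν hν h2 hc2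
  have hNc : Continuous N := by
    have := hG.continuous
    fun_prop
  set q : ℝ × ℝ → ℂ := fun s => s.1 * a + s.2 * (2 * Real.pi * Complex.I)
  have hq : Continuous q := by fun_prop
  obtain ⟨C, hC⟩ := ((isCompact_Icc (a := (0 : ℝ × ℝ)) (b := 1)).image hq).exists_bound_of_continuousOn
    hNc.continuousOn
  have hbd : ∀ u, N u ≤ C := by
    intro u
    -- `s` and `t` are the coordinates of `u` in the real basis `(a, 2πi)`; fractional parts bring
    -- `u` into the compact fundamental parallelogram.
    set s : ℝ := u.re / a.re with hs
    set t : ℝ := (u.im - s * a.im) / (2 * Real.pi) with ht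
    have hu : u = q (Int.fract s, Int.fract t) + (⌊s⌋ : ℤ) * a
        + (⌊t⌋ : ℤ) * (2 * Real.pi * Complex.I) := by
      have hs' : s * a.re = u.re := div_mul_cancel₀ _ ha
      have ht' : t * (2 * Real.pi) = u.im - s * a.im := div_mul_cancel₀ _ (by positivity)
      have e : u = s * a + t * (2 * Real.pi * Complex.I) := by
        clear_value s t
        apply Complex.ext
        · simp [hs']
        · simp [ht']
      have e1 : (s : ℂ) = (⌊s⌋ : ℤ) + Int.fract s := by exact_mod_cast (Int.floor_add_fract s).symm
      have e2 : (t : ℂ) = (⌊t⌋ : ℤ) + Int.fract t := by exact_mod_cast (Int.floor_add_fract t).symm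
      refine e.trans ?_
      simp only [q]
      linear_combination a * e1 + (2 * Real.pi * Complex.I) * e2
    rw [hu, hpb.int_mul _ _, hpa.int_mul _ _]
    refine (le_abs_self _).trans (hC _ ⟨_, ⟨?_, ?_⟩, rfl⟩)
    · exact ⟨Int.fract_nonneg _, Int.fract_nonneg _⟩
    · exact ⟨(Int.fract_lt_one _).le, (Int.fract_lt_one _).le⟩
  have hconst := Differentiable.apply_eq_apply_of_bounded
    (f := fun u => Complex.exp (-(c * u)) • G u) (by fun_prop)
    (isBounded_iff_forall_norm_le.2 ⟨C, by rintro _ ⟨u, rfl⟩; exact hbd u⟩)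
  refine ⟨c, fun u => ?_⟩
  have h := hconst u 0
  simp only [mul_zero, neg_zero, Complex.exp_zero, one_smul] at h
  rw [← h, smul_smul, ← Complex.exp_add, add_neg_cancel, Complex.exp_zero, one_smul]

end ComplexAnalysis

/-! ### Local lifts to the classical Hopf manifold and their ambiguity by powers of `λ`. -/

section LocalLifts

variable {V : Type*} [NormedAddCommGroup V] [NormedSpace ℂ V]

theorem log_norm_zpow_smul (lam : ℂˣ) (n : ℤ) {v : V} (hv : v ≠ 0) :
    Real.log ‖(lam : ℂ) ^ n • v‖ = n * Real.log ‖(lam : ℂ)‖ + Real.log ‖v‖ := by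
  rw [norm_smul, Real.log_mul, norm_zpow, Real.log_zpow]
  · exact norm_ne_zero_iff.2 (zpow_ne_zero _ lam.ne_zero)
  · exact norm_ne_zero_iff.2 hv

theorem scalarAut_zpow_apply (lam : ℂˣ) (n : ℤ) (v : V) :
    (scalarAut V lam ^ n) v = (lam : ℂ) ^ n • v := by
  rw [scalarAut, ← map_zpow, ContinuousLinearEquiv.smulLeft_apply_apply, Units.smul_def,
    Units.val_zpow_eq_zpow_val]

theorem proj_scalarAut_eq_iff {lam : ℂˣ} {v w : V} (hv : v ≠ 0) (hw : w ≠ 0) :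
    HopfManifold.proj (scalarAut V lam) v hv = HopfManifold.proj (scalarAut V lam) w hw ↔
      ∃ n : ℤ, (lam : ℂ) ^ n • v = w := by
  refine Quotient.eq.trans (exists_congr fun n => ?_)
  rw [← scalarAut_zpow_apply]

theorem proj_apply_self {A : V ≃L[ℂ] V} {z : V} (hz : z ≠ 0) (hAz : A z ≠ 0) :
    HopfManifold.proj A (A z) hAz = HopfManifold.proj A z hz :=
  (Quotient.sound (s := hopfSetoid A) ⟨1, by rw [zpow_one]⟩ :
    HopfManifold.proj A z hz = HopfManifold.proj A (A z) hAz).symm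

/-- Points of one orbit of `⟨λ · id⟩` whose logarithmic norms differ by less than `|log |λ||`
agree. -/
theorem eq_of_abs_log_norm_sub_lt {lam : ℂˣ} {v w : V} (hv : v ≠ 0) (hw : w ≠ 0)
    (h : HopfManifold.proj (scalarAut V lam) v hv = HopfManifold.proj (scalarAut V lam) w hw)
    (hlt : |Real.log ‖w‖ - Real.log ‖v‖| < |Real.log ‖(lam : ℂ)‖|) : v = w := by
  obtain ⟨n, rfl⟩ := (proj_scalarAut_eq_iff hv hw).1 h
  rw [log_norm_zpow_smul lam n hv, add_sub_cancel_right, abs_mul] at hlt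
  have hn : n = 0 := by
    by_contra hn
    have h1 : (1 : ℝ) ≤ |(n : ℝ)| := by exact_mod_cast Int.one_le_abs hn
    nlinarith [abs_nonneg (Real.log ‖(lam : ℂ)‖)]
  simp [hn]

/-- The logarithm of the norm, as a function on the classical Hopf manifold. -/
def logNorm (lam : ℂˣ) : HopfManifold (scalarAut V lam) → AddCircle (Real.log ‖(lam : ℂ)‖) :=
  Quotient.lift (fun v => ((Real.log ‖(v : V)‖ : ℝ) : AddCircle (Real.log ‖(lam : ℂ)‖))) (by
    rintro ⟨v, hv⟩ ⟨w, hw⟩ ⟨n, hn⟩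
    have hn : (lam : ℂ) ^ n • v = w := (scalarAut_zpow_apply lam n v).symm.trans hn
    change ((Real.log ‖v‖ : ℝ) : AddCircle (Real.log ‖(lam : ℂ)‖)) = (Real.log ‖w‖ : ℝ)
    rw [← hn, log_norm_zpow_smul lam n hv, AddCircle.coe_add, ← zsmul_eq_mul, AddCircle.coe_zsmul,
      AddCircle.coe_period, smul_zero, zero_add])

theorem logNorm_proj (lam : ℂˣ) {v : V} (hv : v ≠ 0) :
    logNorm lam (HopfManifold.proj (scalarAut V lam) v hv) = (Real.log ‖v‖ : ℝ) := rfl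

variable {E : Type*} [NormedAddCommGroup E] [NormedSpace ℂ E] {A : E ≃L[ℂ] E} {lam : ℂˣ}
  {f : HopfManifold A → HopfManifold (scalarAut V lam)}

namespace IsLocalLift

variable {U U' : Set E} {F F' : E → V}

theorem ne_zero (h : IsLocalLift f U F) {z : E} (hz : z ∈ U) : z ≠ 0 := (h.lift z hz).1

theorem apply_ne_zero (h : IsLocalLift f U F) {z : E} (hz : z ∈ U) : F z ≠ 0 := (h.lift z hz).2.1

theorem map_proj (h : IsLocalLift f U F) {z : E} (hz : z ∈ U) :
    f (HopfManifold.proj A z (h.ne_zero hz))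
      = HopfManifold.proj (scalarAut V lam) (F z) (h.apply_ne_zero hz) := (h.lift z hz).2.2

theorem differentiableAt (h : IsLocalLift f U F) {z : E} (hz : z ∈ U) :
    DifferentiableAt ℂ F z :=
  h.differentiableOn.differentiableAt (h.isOpen.mem_nhds hz)

theorem zpow_smul (h : IsLocalLift f U F) (n : ℤ) :
    IsLocalLift f U (fun z => (lam : ℂ) ^ n • F z) where
  isOpen := h.isOpen
  differentiableOn := h.differentiableOn.const_smul _
  lift z hz := by
    refine ⟨h.ne_zero hz, smul_ne_zero (zpow_ne_zero _ lam.ne_zero) (h.apply_ne_zero hz), ?_⟩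
    rw [h.map_proj hz]
    exact (proj_scalarAut_eq_iff _ _).2 ⟨n, rfl⟩

/-- Precomposition of a local lift with a linear automorphism preserving the orbits. -/
theorem comp_automorphism (h : IsLocalLift f U F) (B : E ≃L[ℂ] E)
    (hB : ∀ z (hz : z ≠ 0) (hBz : B z ≠ 0),
      HopfManifold.proj A (B z) hBz = HopfManifold.proj A z hz) :
    IsLocalLift f (B ⁻¹' U) (fun z => F (B z)) where
  isOpen := h.isOpen.preimage B.continuous
  differentiableOn := fun z hz =>
    ((h.differentiableAt hz).comp z B.differentiableAt).differentiableWithinAt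
  lift z hz := by
    have hz0 : z ≠ 0 := fun h0 => h.ne_zero hz (by rw [h0, map_zero])
    refine ⟨hz0, h.apply_ne_zero hz, ?_⟩
    rw [← hB z hz0 (h.ne_zero hz)]
    exact h.map_proj hz

/-- Two local lifts which agree at a point agree near that point. -/
theorem eventuallyEq (hlam : ‖(lam : ℂ)‖ ≠ 1) (h : IsLocalLift f U F) (h' : IsLocalLift f U' F')
    {z : E} (hz : z ∈ U) (hz' : z ∈ U') (he : F z = F' z) : F =ᶠ[𝓝 z] F' := by
  have hT : 0 < |Real.log ‖(lam : ℂ)‖| :=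
    abs_pos.2 (Real.log_ne_zero_of_pos_of_ne_one (norm_pos_iff.2 lam.ne_zero) hlam)
  have hc : ContinuousAt (fun z => |Real.log ‖F' z‖ - Real.log ‖F z‖|) z :=
    (((h'.differentiableAt hz').continuousAt.norm.log
      (norm_ne_zero_iff.2 (h'.apply_ne_zero hz'))).sub
      ((h.differentiableAt hz).continuousAt.norm.log
      (norm_ne_zero_iff.2 (h.apply_ne_zero hz)))).abs
  have hlt : ∀ᶠ w in 𝓝 z, |Real.log ‖F' w‖ - Real.log ‖F w‖| < |Real.log ‖(lam : ℂ)‖| :=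
    hc.eventually_lt_const (by simpa [he] using hT)
  filter_upwards [hlt, h.isOpen.mem_nhds hz, h'.isOpen.mem_nhds hz'] with w hw hwU hwU'
  exact eq_of_abs_log_norm_sub_lt (h.apply_ne_zero hwU) (h'.apply_ne_zero hwU')
    ((h.map_proj hwU).symm.trans (h'.map_proj hwU')) hw

end IsLocalLift

end LocalLifts

/-! ### Lifts along the curve `z₂ = 0` and their degeneracy. -/

section ExponentialChart

local notation "ℂ²" => EuclideanSpace ℂ (Fin 2)

/-- The map `(u, w) ↦ (e^u, w)`. -/
def expChart (x : ℂ × ℂ) : EuclideanSpace ℂ (Fin 2) := !₂[Complex.exp x.1, x.2]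

theorem expChart_ne_zero (x : ℂ × ℂ) : expChart x ≠ 0 := fun h =>
  Complex.exp_ne_zero x.1 (by simpa [expChart] using congrArg (fun z : ℂ² => z 0) h)

theorem differentiable_expChart : Differentiable ℂ expChart := by
  rw [differentiable_euclidean]
  intro i
  fin_cases i 
  · simp [expChart]
  · simp [expChart]

theorem hasDerivAt_expChart_snd (u w : ℂ) :
    HasDerivAt (fun w => expChart (u, w)) (EuclideanSpace.single 1 1) w := by
  have : (fun w => expChart (u, w))
      = fun w => expChart (u, 0) + w • (EuclideanSpace.single 1 1 : ℂ²) := by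
    funext w
    ext i
    fin_cases i <;> simp [expChart]
  rw [this]
  simpa using ((hasDerivAt_id w).smul_const (EuclideanSpace.single 1 1 : ℂ²)).const_add
    (expChart (u, 0))

variable {V : Type*} [NormedAddCommGroup V] [NormedSpace ℂ V] {A : ℂ² ≃L[ℂ] ℂ²} {lam : ℂˣ}
  {f : HopfManifold A → HopfManifold (scalarAut V lam)}

/-- `F` is a local lift of `f` near `(e^u, 0)` with `log ‖F‖` equal to `L u` there. -/
def IsNormalisedLift (f : HopfManifold A → HopfManifold (scalarAut V lam)) (L : ℂ → ℝ) (u : ℂ)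
    (F : ℂ² → V) : Prop :=
  ∃ U : Set ℂ², expChart (u, 0) ∈ U ∧ IsLocalLift f U F ∧ Real.log ‖F (expChart (u, 0))‖ = L u

/-- `L` is a continuous choice of `log ‖F‖` for local lifts `F` of `f` along the curve
`u ↦ (e^u, 0)`. -/
def IsLogNormAlong (f : HopfManifold A → HopfManifold (scalarAut V lam)) (L : ℂ → ℝ) : Prop :=
  Continuous L ∧ ∀ u, ((L u : ℝ) : AddCircle (Real.log ‖(lam : ℂ)‖))
    = logNorm lam (f (HopfManifold.proj A (expChart (u, 0)) (expChart_ne_zero _)))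

/-- The circle-valued function is continuous because it is locally `log ‖F‖` modulo the period, and
`ℂ` is simply connected. Lifting this scalar function replaces lifting `f` through the covering of
its target. -/
theorem exists_isLogNormAlong (hf : IsHolomorphic f) : ∃ L : ℂ → ℝ, IsLogNormAlong f L := by
  set φ : ℂ → AddCircle (Real.log ‖(lam : ℂ)‖) := fun u =>
    logNorm lam (f (HopfManifold.proj A (expChart (u, 0)) (expChart_ne_zero _))) with hφdef
  have hpc : Continuous fun u : ℂ => expChart (u, 0) :=
    differentiable_expChart.continuous.comp (by fun_prop)
  have hφ : Continuous φ := by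
    rw [continuous_iff_continuousAt]
    intro u
    obtain ⟨U, F, hzU, hF⟩ := hf _ (expChart_ne_zero (u, 0))
    have he : (fun u => ((Real.log ‖F (expChart (u, 0))‖ : ℝ) :
        AddCircle (Real.log ‖(lam : ℂ)‖))) =ᶠ[𝓝 u] φ := by
      filter_upwards [hpc.continuousAt (hF.isOpen.mem_nhds hzU)] with v hv
      rw [hφdef]
      simp only
      rw [hF.map_proj hv, logNorm_proj]
    refine ContinuousAt.congr ?_ he
    have h1 : ContinuousAt (fun u => F (expChart (u, 0))) u :=
      ContinuousAt.comp (f := fun u : ℂ => expChart (u, 0)) (hF.differentiableAt hzU).continuousAt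
        hpc.continuousAt
    exact (AddCircle.continuous_mk' _).continuousAt.comp
      (h1.norm.log (norm_ne_zero_iff.2 (hF.apply_ne_zero hzU)))
  obtain ⟨t, ht⟩ := QuotientAddGroup.mk_surjective (φ 0)
  obtain ⟨L, ⟨-, hL⟩, -⟩ :=
    (AddCircle.isCoveringMap_coe (Real.log ‖(lam : ℂ)‖)).existsUnique_continuousMap_lifts
      ⟨φ, hφ⟩ 0 t ht
  exact ⟨L, L.continuous, fun u => congrFun hL u⟩

variable {L : ℂ → ℝ}

/-- For any local lift, `log ‖F‖` differs from `L u` by an integer multiple of `log |λ|`, which a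
power of `λ` absorbs. -/
theorem IsLogNormAlong.exists_isNormalisedLift (hL : IsLogNormAlong f L) (hf : IsHolomorphic f)
    (u : ℂ) : ∃ F : ℂ² → V, IsNormalisedLift f L u F := by
  obtain ⟨U, F, hzU, hF⟩ := hf _ (expChart_ne_zero (u, 0))
  have h := hL.2 u
  rw [hF.map_proj hzU, logNorm_proj, eq_comm, ← sub_eq_zero, ← AddCircle.coe_sub,
    AddCircle.coe_eq_zero_iff] at h
  obtain ⟨n, hn⟩ := h
  refine ⟨_, U, hzU, hF.zpow_smul (-n), ?_⟩
  rw [log_norm_zpow_smul _ _ (hF.apply_ne_zero hzU)]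
  rw [zsmul_eq_mul] at hn
  push_cast
  linarith

/-- Since `log |λ| ≠ 0`, the prescribed norm leaves no freedom for a power of `λ`. Values and
derivatives of normalised lifts are thus independent of choices. -/
theorem IsNormalisedLift.eventuallyEq (hlam : ‖(lam : ℂ)‖ ≠ 1) {u : ℂ} {F F' : ℂ² → V}
    (h : IsNormalisedLift f L u F) (h' : IsNormalisedLift f L u F') :
    F =ᶠ[𝓝 (expChart (u, 0))] F' := by
  obtain ⟨U, hzU, hF, hn⟩ := h
  obtain ⟨U', hzU', hF', hn'⟩ := h'
  refine hF.eventuallyEq hlam hF' hzU hzU' ?_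
  refine eq_of_abs_log_norm_sub_lt (lam := lam) (hF.apply_ne_zero hzU) (hF'.apply_ne_zero hzU')
    ((hF.map_proj hzU).symm.trans (hF'.map_proj hzU')) ?_
  rw [hn, hn', sub_self, abs_zero]
  exact abs_pos.2 (Real.log_ne_zero_of_pos_of_ne_one (norm_pos_iff.2 lam.ne_zero) hlam)

/-- The defect `log ‖F‖ - L` is continuous, takes values in the discrete set `ℤ log |λ|` and
vanishes at `u`. Hence one holomorphic map serves for all nearby points. -/
theorem IsNormalisedLift.eventually (hlam : ‖(lam : ℂ)‖ ≠ 1) (hf : IsHolomorphic f)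
    (hL : IsLogNormAlong f L) {u : ℂ} {F : ℂ² → V} (h : IsNormalisedLift f L u F) :
    ∀ᶠ v in 𝓝 u, IsNormalisedLift f L v F := by
  obtain ⟨U, hzU, hF, hn⟩ := h
  have hT : 0 < |Real.log ‖(lam : ℂ)‖| :=
    abs_pos.2 (Real.log_ne_zero_of_pos_of_ne_one (norm_pos_iff.2 lam.ne_zero) hlam)
  have hpc : Continuous fun u : ℂ => expChart (u, 0) :=
    differentiable_expChart.continuous.comp (by fun_prop)
  have h1 : ContinuousAt (fun u => F (expChart (u, 0))) u :=
    ContinuousAt.comp (f := fun u : ℂ => expChart (u, 0)) (hF.differentiableAt hzU).continuousAt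
      hpc.continuousAt
  have hlt : ∀ᶠ v in 𝓝 u, |Real.log ‖F (expChart (v, 0))‖ - L v| < |Real.log ‖(lam : ℂ)‖| :=
    (((h1.norm.log (norm_ne_zero_iff.2 (hF.apply_ne_zero hzU))).sub
      hL.1.continuousAt).abs).eventually_lt_const (by simpa [hn] using hT)
  filter_upwards [hlt, hpc.continuousAt (hF.isOpen.mem_nhds hzU)] with v hv hvU
  refine ⟨U, hvU, hF, ?_⟩
  obtain ⟨F', U', hvU', hF', hn'⟩ := hL.exists_isNormalisedLift hf v
  rw [← hn'] at hv ⊢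
  rw [eq_of_abs_log_norm_sub_lt (hF'.apply_ne_zero hvU') (hF.apply_ne_zero hvU)
    ((hF'.map_proj hvU').symm.trans (hF.map_proj hvU)) hv]

/-- The translation behaviour of the normalised lifts under a symmetry `(u, w) ↦ (u + b, s w)` of
the exponential chart. -/
theorem IsLogNormAlong.exists_zpow (hL : IsLogNormAlong f L)
    (B : ℂ² ≃L[ℂ] ℂ²)
    (hB : ∀ z (hz : z ≠ 0) (hBz : B z ≠ 0),
      HopfManifold.proj A (B z) hBz = HopfManifold.proj A z hz)
    {b s : ℂ} (hchart : ∀ u w, B (expChart (u, w)) = expChart (u + b, s * w)) :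
    ∃ k : ℤ, ∀ u F, IsNormalisedLift f L (u + b) F →
      IsNormalisedLift f L u (fun z => (lam : ℂ) ^ (-k) • F (B z)) := by
  have hproj : ∀ u, HopfManifold.proj A (expChart (u + b, 0)) (expChart_ne_zero _)
      = HopfManifold.proj A (expChart (u, 0)) (expChart_ne_zero _) := by
    intro u
    have e : B (expChart (u, 0)) = expChart (u + b, 0) := by rw [hchart, mul_zero]
    rw [← hB (expChart (u, 0)) (expChart_ne_zero _) (e ▸ expChart_ne_zero _)]
    congr 1
    exact e.symm
  have hcoe : ∀ u, ((L (u + b) : ℝ) : AddCircle (Real.log ‖(lam : ℂ)‖)) = (L u : ℝ) := by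
    intro u
    rw [hL.2, hL.2, hproj]
  obtain ⟨k, hk⟩ := AddCircle.coe_eq_zero_iff (x := L (0 + b) - L 0)
    (p := Real.log ‖(lam : ℂ)‖) |>.1 (by rw [AddCircle.coe_sub, hcoe, sub_self])
  rw [zsmul_eq_mul] at hk
  -- Both sides lift the same circle-valued map and agree at `0`; uniqueness of lifts makes `k`
  -- independent of `u`.
  have hshift : (fun u => L (u + b)) = fun u => L u + k * Real.log ‖(lam : ℂ)‖ := by
    have hLc := hL.1
    refine (AddCircle.isCoveringMap_coe (Real.log ‖(lam : ℂ)‖)).eq_of_comp_eq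
      (by fun_prop) (by fun_prop) (funext fun u => ?_) 0 (by linarith)
    simp only [Function.comp_apply]
    rw [hcoe, AddCircle.coe_add, ← zsmul_eq_mul, AddCircle.coe_zsmul, AddCircle.coe_period,
      smul_zero, add_zero]
  refine ⟨k, fun u F ⟨U, hzU, hF, hn⟩ => ?_⟩
  have e : B (expChart (u, 0)) = expChart (u + b, 0) := by rw [hchart, mul_zero]
  have hz : expChart (u, 0) ∈ B ⁻¹' U := by rw [Set.mem_preimage, e]; exact hzU
  refine ⟨B ⁻¹' U, hz, (hF.comp_automorphism B hB).zpow_smul (-k), ?_⟩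
  rw [log_norm_zpow_smul _ _ (hF.apply_ne_zero hz), e, hn, congrFun hshift u]
  push_cast
  ring

theorem hasDerivAt_comp_expChart_snd {F : ℂ² → V} {u w : ℂ}
    (hF : DifferentiableAt ℂ F (expChart (u, w))) :
    HasDerivAt (fun w => F (expChart (u, w)))
      (fderiv ℂ F (expChart (u, w)) (EuclideanSpace.single 1 1)) w :=
  hF.hasFDerivAt.comp_hasDerivAt w (hasDerivAt_expChart_snd u w)

/-- On a diagonal Hopf surface with `|α| = |β| ≠ 1`, `α ≠ β`, every holomorphic map to a classical
Hopf manifold has a local lift which is degenerate in the normal direction of the curve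
`z₂ = 0`. -/
theorem exists_localLift_fderiv_eq_zero [CompleteSpace V] {α β : ℂˣ} (hne : α ≠ β)
    (habs : ‖(α : ℂ)‖ = ‖(β : ℂ)‖) (hone : ‖(α : ℂ)‖ ≠ 1) (hlam : ‖(lam : ℂ)‖ ≠ 1)
    {f : HopfManifold (diagAut α β) → HopfManifold (scalarAut V lam)} (hf : IsHolomorphic f) :
    ∃ (U : Set ℂ²) (F : ℂ² → V) (z : ℂ²), IsLocalLift f U F ∧ z ∈ U ∧
      fderiv ℂ F z (EuclideanSpace.single 1 1) = 0 := by
  by_contra! hcon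
  obtain ⟨L, hL⟩ := exists_isLogNormAlong hf
  choose F hF using hL.exists_isNormalisedLift hf
  set G : ℂ → V := fun u => F u (expChart (u, 0)) with hG
  set H : ℂ → V := fun u => deriv (fun w => F u (expChart (u, w))) 0 with hH
  have hcont : ∀ u, Tendsto (fun w => expChart (u, w)) (𝓝 0) (𝓝 (expChart (u, 0))) := fun u =>
    (hasDerivAt_expChart_snd u 0).continuousAt
  have hval : ∀ u F', IsNormalisedLift f L u F' →
      G u = F' (expChart (u, 0)) ∧ H u = deriv (fun w => F' (expChart (u, w))) 0 := by
    intro u F' hF'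
    have he := (hF u).eventuallyEq hlam hF'
    exact ⟨he.self_of_nhds, (he.comp_tendsto (hcont u)).deriv_eq⟩
  have hGd : Differentiable ℂ G := by
    intro u
    obtain ⟨U, hzU, hlift, -⟩ := hF u
    have he : G =ᶠ[𝓝 u] fun v => F u (expChart (v, 0)) :=
      ((hF u).eventually hlam hf hL).mono fun v hv => (hval v _ hv).1
    refine DifferentiableAt.congr_of_eventuallyEq ?_ he
    exact DifferentiableAt.comp (f := fun v : ℂ => expChart (v, 0)) u (hlift.differentiableAt hzU)
      (differentiable_expChart.differentiableAt.comp u (by fun_prop))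
  have hHd : Differentiable ℂ H := by
    intro u
    obtain ⟨U, hzU, hlift, -⟩ := hF u
    have he : H =ᶠ[𝓝 u] fun v => deriv (fun w => F u (expChart (v, w))) 0 :=
      ((hF u).eventually hlam hf hL).mono fun v hv => (hval v _ hv).2
    refine DifferentiableAt.congr_of_eventuallyEq ?_ he
    refine differentiableAt_deriv_snd (Ψ := fun x => F u (expChart x)) ?_
    filter_upwards [differentiable_expChart.continuous.continuousAt
      (hlift.isOpen.mem_nhds hzU)] with x hx
    exact (hlift.differentiableAt hx).comp x differentiable_expChart.differentiableAt
  have hG0 : G 0 ≠ 0 := by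
    obtain ⟨U, hzU, hlift, -⟩ := hF 0
    exact hlift.apply_ne_zero hzU
  have hH0 : H 0 ≠ 0 := by
    obtain ⟨U, hzU, hlift, -⟩ := hF 0
    rw [hH]
    simp only
    rw [(hasDerivAt_comp_expChart_snd (hlift.differentiableAt hzU)).deriv]
    exact hcon U _ _ hlift hzU
  -- `λ^(-k) F ∘ B` is again a normalised lift. Evaluating it gives the rule for `G`;
  -- differentiating in `w` yields an extra factor `s` by the chain rule, hence `s⁻¹` in the rule
  -- for `H`.
  have hquasi : ∀ (B : ℂ² ≃L[ℂ] ℂ²) (b s : ℂ), (∀ z (hz : z ≠ 0) (hBz : B z ≠ 0),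
      HopfManifold.proj (diagAut α β) (B z) hBz = HopfManifold.proj (diagAut α β) z hz) →
      (∀ u w, B (expChart (u, w)) = expChart (u + b, s * w)) → s ≠ 0 →
      ∃ k : ℤ, (∀ u, G (u + b) = (lam : ℂ) ^ k • G u) ∧
        ∀ u, H (u + b) = ((lam : ℂ) ^ k * s⁻¹) • H u := by
    intro B b s hB hchart hs
    obtain ⟨k, hk⟩ := hL.exists_zpow B hB hchart
    refine ⟨k, fun u => ?_, fun u => ?_⟩
    · rw [(hval u _ (hk u _ (hF (u + b)))).1, hchart, mul_zero, smul_smul, ← zpow_add₀ lam.ne_zero,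
        add_neg_cancel, zpow_zero, one_smul]
    · obtain ⟨U, hzU, hlift, -⟩ := hF (u + b)
      have hd := hasDerivAt_comp_expChart_snd (hlift.differentiableAt hzU)
      have hd' : HasDerivAt (fun w => (lam : ℂ) ^ (-k) • F (u + b) (B (expChart (u, w))))
          ((lam : ℂ) ^ (-k) • s • H (u + b)) 0 := by
        refine HasDerivAt.const_smul _ ?_
        simp only [hchart]
        have hsw : HasDerivAt (fun w : ℂ => s * w) s 0 := by
          simpa using (hasDerivAt_id (0 : ℂ)).const_mul s
        have hd0 : HasDerivAt (fun w => F (u + b) (expChart (u + b, w))) (H (u + b)) (s * 0) := by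
          rw [mul_zero]
          exact hd.differentiableAt.hasDerivAt
        exact hd0.scomp 0 hsw
      rw [(hval u _ (hk u _ (hF (u + b)))).2, hd'.deriv, smul_smul, smul_smul]
      have : (lam : ℂ) ^ k * s⁻¹ * (lam : ℂ) ^ (-k) * s = 1 := by
        rw [zpow_neg]
        have := zpow_ne_zero k lam.ne_zero
        field_simp
      rw [this, one_smul]
  obtain ⟨a, ha⟩ : ∃ a, Complex.exp a = α := ⟨_, Complex.exp_log α.ne_zero⟩
  have hare : a.re ≠ 0 := by
    intro h
    apply hone
    rw [← ha, Complex.norm_exp, h, Real.exp_zero]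
  obtain ⟨k, hGk, hHk⟩ := hquasi (diagAut α β) a β (fun z hz hBz => proj_apply_self hz hBz)
    (fun u w => by
      ext i
      fin_cases i <;> simp [expChart, diagAut, Complex.exp_add, ha, mul_comm]) β.ne_zero
  -- The second period comes from the chart itself: `u ↦ u + 2πi` covers the identity.
  obtain ⟨l, hGl, hHl⟩ := hquasi (ContinuousLinearEquiv.refl ℂ ℂ²) (2 * Real.pi * Complex.I) 1
    (fun z hz hBz => rfl)
    (fun u w => by
      ext i
      fin_cases i <;> simp [expChart, Complex.exp_add, Complex.exp_two_pi_mul_I]) one_ne_zero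
  rw [inv_one, mul_one] at hHl
  have hk0 := zpow_ne_zero k lam.ne_zero
  have hl0 := zpow_ne_zero l lam.ne_zero
  obtain ⟨c, hc⟩ := exists_eq_exp_smul_of_quasiperiodic hGd hare hk0 hl0 hGk hGl
  obtain ⟨d, hd⟩ := exists_eq_exp_smul_of_quasiperiodic hHd hare
    (mul_ne_zero hk0 (inv_ne_zero β.ne_zero)) hl0 hHk hHl
  have hmul : ∀ {K : ℂ → V} {c b μ : ℂ}, K 0 ≠ 0 → (∀ u, K u = Complex.exp (c * u) • K 0) →
      (∀ u, K (u + b) = μ • K u) → Complex.exp (c * b) = μ := by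
    intro K c b μ hK0 hK hb
    have h := hb 0
    rw [zero_add, hK b] at h
    exact smul_left_injective ℂ hK0 h
  have e1 := hmul hG0 hc hGk
  have e2 := hmul hG0 hc hGl
  have e3 := hmul hH0 hd hHk
  have e4 := hmul hH0 hd hHl
  -- `G` and `H` share the multiplier for `2πi`, so `c - d` is an integer `n`; their multipliers for
  -- `a` differ by `β`, so `e^{na} = α^n = β`.
  obtain ⟨n, hn⟩ := Complex.exp_eq_exp_iff_exists_int.1 (e2.trans e4.symm)
  have hcd : c = d + n := by
    have : (2 * Real.pi * Complex.I : ℂ) ≠ 0 := Complex.two_pi_I_ne_zero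
    refine mul_right_cancel₀ this ?_
    rw [hn]
    ring
  have hαβ : (α : ℂ) ^ n = β := by
    rw [hcd, add_mul, Complex.exp_add, e3, Complex.exp_int_mul, ha] at e1
    have := β.ne_zero
    field_simp at e1
    exact e1
  have hn1 : n = 1 := by
    have h : ‖(α : ℂ)‖ ^ n = ‖(α : ℂ)‖ ^ (1 : ℤ) := by
      rw [← norm_zpow, hαβ, zpow_one, habs]
    exact zpow_right_injective₀ (norm_pos_iff.2 α.ne_zero) hone h
  rw [hn1, zpow_one] at hαβ
  exact hne (Units.ext hαβ)

end ExponentialChart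

/-! ### Absence of Hopf-induced metrics. -/

/-- There are no Hopf-induced Hermitian metrics on a diagonal Hopf surface with
`|α| = |β| ≠ 1` and `α ≠ β`. -/
theorem not_isInducedBy {V : Type*} [NormedAddCommGroup V] [InnerProductSpace ℂ V]
    [CompleteSpace V] {α β : ℂˣ} (hne : α ≠ β) (habs : ‖(α : ℂ)‖ = ‖(β : ℂ)‖)
    (hone : ‖(α : ℂ)‖ ≠ 1) {lam : ℂˣ} (hlam : ‖(lam : ℂ)‖ ≠ 1)
    (g : HermitianMetric (diagAut α β)) : ¬ IsInducedBy V lam g := by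
  rintro ⟨f, hf, hpull⟩
  obtain ⟨U, F, z, hlift, hz, hzero⟩ := exists_localLift_fderiv_eq_zero hne habs hone hlam hf
  have h := hpull U F hlift z hz (EuclideanSpace.single 1 1) (EuclideanSpace.single 1 1)
  have hpos := g.pos z (hlift.ne_zero hz) (EuclideanSpace.single 1 1) (by simp)
  rw [h, hzero, map_zero] at hpos
  exact lt_irrefl _ hpos

theorem not_isHopfInduced {α β : ℂˣ} (hne : α ≠ β) (habs : ‖(α : ℂ)‖ = ‖(β : ℂ)‖)
    (hone : ‖(α : ℂ)‖ ≠ 1) (g : HermitianMetric (diagAut α β)) : ¬ IsHopfInduced g := by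
  rintro ⟨lam, hlam, ⟨N, h⟩ | h⟩
  · exact not_isInducedBy hne habs hone hlam g h
  · exact not_isInducedBy hne habs hone hlam g h

/-! ### The metric `‖z‖⁻² g₀` is Vaisman. -/

section ConformallyFlat

variable {E : Type*} [NormedAddCommGroup E] [InnerProductSpace ℂ E]

theorem flatMetric_symm (X Y : E) : flatMetric E X Y = flatMetric E Y X := by
  rw [flatMetric_apply, flatMetric_apply, ← inner_conj_symm X Y, Complex.conj_re]

theorem flatMetric_self (X : E) : flatMetric E X X = ‖X‖ ^ 2 := by
  rw [flatMetric_apply, inner_self_eq_norm_sq_to_K]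
  norm_cast

theorem flatMetric_smul_I (X Y : E) :
    flatMetric E (Complex.I • X) (Complex.I • Y) = flatMetric E X Y := by
  simp [flatMetric_apply, ← mul_assoc]

theorem hasFDerivAt_norm_sq_flatMetric (z : E) :
    HasFDerivAt (fun z : E => ‖z‖ ^ 2) ((2 : ℝ) • flatMetric E z) z := by
  have h := (flatMetric E).hasFDerivAt_of_bilinear (hasFDerivAt_id (𝕜 := ℝ) z) (hasFDerivAt_id z)
  simp only [id, flatMetric_self] at h
  refine h.congr_fderiv ?_
  ext X
  simp [two_mul, flatMetric_symm X z]

theorem hasFDerivAt_inv_norm_sq {z : E} (hz : z ≠ 0) :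
    HasFDerivAt (fun z : E => (‖z‖ ^ 2)⁻¹) ((-2 * ((‖z‖ ^ 2)⁻¹) ^ 2) • flatMetric E z) z := by
  have hρ : ‖z‖ ^ 2 ≠ 0 := pow_ne_zero 2 (norm_ne_zero_iff.2 hz)
  refine ((hasDerivAt_inv hρ).comp_hasFDerivAt z (hasFDerivAt_norm_sq_flatMetric z)).congr_fderiv ?_
  rw [smul_smul]
  congr 1
  field_simp

/-- The metric `‖z‖⁻² g₀` on the linear Hopf manifold of a homothety `A`. -/
def homothetyMetric (A : E ≃L[ℂ] E) (r : ℝ) (hr : r ≠ 0)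
    (hA : ∀ X Y, flatMetric E (A X) (A Y) = r * flatMetric E X Y) : HermitianMetric A where
  toFun z := (‖z‖ ^ 2)⁻¹ • flatMetric E
  -- These four conditions do not involve the deck transformation, so they carry over from the
  -- classical metric with `λ = 1`.
  smooth := (classicalHopfMetric E 1).smooth
  symm := (classicalHopfMetric E 1).symm
  pos := (classicalHopfMetric E 1).pos
  map_I := (classicalHopfMetric E 1).map_I
  invariant z hz X Y := by
    change (‖A z‖ ^ 2)⁻¹ * flatMetric E (A X) (A Y) = (‖z‖ ^ 2)⁻¹ * flatMetric E X Y
    rw [hA, ← flatMetric_self, hA, flatMetric_self]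
    field_simp

variable {A : E ≃L[ℂ] E} {r : ℝ} {hr : r ≠ 0}
  {hA : ∀ X Y, flatMetric E (A X) (A Y) = r * flatMetric E X Y}

theorem homothetyMetric_apply (z X Y : E) :
    (homothetyMetric A r hr hA).toFun z X Y = (‖z‖ ^ 2)⁻¹ * flatMetric E X Y := rfl

theorem fderiv_homothetyMetric {z : E} (hz : z ≠ 0) (X Y Z : E) :
    fderiv ℝ (homothetyMetric A r hr hA).toFun z X Y Z
      = -2 * ((‖z‖ ^ 2)⁻¹) ^ 2 * flatMetric E z X * flatMetric E Y Z := by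
  have h := (hasFDerivAt_inv_norm_sq hz).smul_const (flatMetric E)
  change fderiv ℝ (fun z : E => (‖z‖ ^ 2)⁻¹ • flatMetric E) z X Y Z = _
  rw [h.fderiv]
  simp

theorem fderiv_fundForm_homothetyMetric {z : E} (hz : z ≠ 0) (X Y Z : E) :
    fderiv ℝ (fundForm (homothetyMetric A r hr hA) Y Z) z X
      = -2 * ((‖z‖ ^ 2)⁻¹) ^ 2 * flatMetric E z X * flatMetric E (Complex.I • Y) Z := by
  have h := (hasFDerivAt_inv_norm_sq hz).mul_const (flatMetric E (Complex.I • Y) Z)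
  change fderiv ℝ (fun z : E => (‖z‖ ^ 2)⁻¹ * flatMetric E (Complex.I • Y) Z) z X = _
  rw [h.fderiv]
  simp
  ring

/-- The Lee form `-d log ‖z‖²` of `‖z‖⁻² g₀`. -/
def homothetyLeeForm (E : Type*) [NormedAddCommGroup E] [InnerProductSpace ℂ E] (z : E) :
    E →L[ℝ] ℝ :=
  (-2 * (‖z‖ ^ 2)⁻¹) • flatMetric E z

theorem homothetyLeeForm_apply (z X : E) :
    homothetyLeeForm E z X = -2 * (‖z‖ ^ 2)⁻¹ * flatMetric E z X := rfl

theorem fderiv_homothetyLeeForm {z : E} (hz : z ≠ 0) (X Y : E) :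
    fderiv ℝ (homothetyLeeForm E) z X Y = -2 * (‖z‖ ^ 2)⁻¹ * flatMetric E X Y
      + 4 * ((‖z‖ ^ 2)⁻¹) ^ 2 * flatMetric E z X * flatMetric E z Y := by
  have h := ((hasFDerivAt_inv_norm_sq hz).const_mul (-2)).smul (flatMetric E).hasFDerivAt
  rw [show fderiv ℝ (homothetyLeeForm E) z = _ from h.fderiv]
  simp only [add_apply, smul_apply, ContinuousLinearMap.smulRight_apply, smul_eq_mul]
  ring

/-- The flat fundamental form has constant coefficients, so only the conformal factor is
differentiated and `dω = -d log ‖z‖² ∧ ω`. -/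
theorem isLeeForm_homothetyMetric :
    IsLeeForm (homothetyMetric A r hr hA) (homothetyLeeForm E) where
  smooth := by
    have h1 : ContDiffOn ℝ ∞ (fun z : E => ‖z‖ ^ 2) {0}ᶜ := by
      let _ : InnerProductSpace ℝ E := InnerProductSpace.rclikeToReal ℂ E
      exact (contDiff_norm_sq ℝ (E := E) (n := ∞)).contDiffOn
    have h2 : ContDiffOn ℝ ∞ (fun z : E => (‖z‖ ^ 2)⁻¹) {0}ᶜ := by
      refine h1.inv fun z hz => ?_
      have : z ≠ 0 := hz
      simpa using this
    exact (contDiffOn_const.mul h2).smul (flatMetric E).contDiff.contDiffOn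
  invariant z hz X := by
    rw [homothetyLeeForm_apply, homothetyLeeForm_apply, ← flatMetric_self, hA, hA, flatMetric_self]
    field_simp
  closed z hz X Y := by
    rw [fderiv_homothetyLeeForm hz, fderiv_homothetyLeeForm hz, flatMetric_symm Y X]
    ring
  lck z hz X Y Z := by
    simp only [fderiv_fundForm_homothetyMetric hz, homothetyLeeForm_apply, fundForm,
      homothetyMetric_apply]
    ring

theorem isParallel_homothetyLeeForm :
    IsParallel (homothetyMetric A r hr hA) (homothetyLeeForm E) := by
  intro z hz X Y
  have hρ : ‖z‖ ^ 2 ≠ 0 := pow_ne_zero 2 (norm_ne_zero_iff.2 hz)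
  -- The conformal change formula `∇_X Y = X(φ) Y + Y(φ) X - g₀(X, Y) grad φ` for `e^{2φ} g₀`, with
  -- `φ = -log ‖z‖` and `X`, `Y` constant.
  refine ⟨-(‖z‖ ^ 2)⁻¹ • (flatMetric E z X • Y + flatMetric E z Y • X - flatMetric E X Y • z),
    fun Z => ?_, ?_⟩
  · simp only [fderiv_homothetyMetric hz, homothetyMetric_apply, map_smul, map_add, map_sub,
      smul_apply, add_apply,
      sub_apply, smul_eq_mul]
    ring
  · simp only [fderiv_homothetyLeeForm hz, homothetyLeeForm_apply, map_smul, map_add, map_sub,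
      smul_eq_mul, flatMetric_self]
    field_simp
    ring

theorem isVaisman_homothetyMetric : IsVaisman (homothetyMetric A r hr hA) :=
  ⟨_, isLeeForm_homothetyMetric, isParallel_homothetyLeeForm⟩

/-- The Hessian of `‖z‖²` is `2 g₀`, which is invariant under `i`; the factor `1/4` cancels the two
copies. -/
theorem ddcTensor_norm_sq (z X Y : E) :
    ddcTensor (fun z : E => ‖z‖ ^ 2) z X Y = flatMetric E X Y := by
  have h : fderiv ℝ (fun z : E => ‖z‖ ^ 2) = ((2 : ℝ) • flatMetric E : E →L[ℝ] E →L[ℝ] ℝ) :=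
    funext fun z => (hasFDerivAt_norm_sq_flatMetric z).fderiv
  rw [ddcTensor, h, ContinuousLinearMap.fderiv]
  simp only [smul_apply, flatMetric_smul_I, smul_eq_mul]
  ring

end ConformallyFlat

/-! ### The diagonal surface with `|α| = |β|`, and the conclusion. -/

theorem flatMetric_diagAut {α β : ℂˣ} (habs : ‖(α : ℂ)‖ = ‖(β : ℂ)‖)
    (X Y : EuclideanSpace ℂ (Fin 2)) :
    flatMetric _ (diagAut α β X) (diagAut α β Y) = ‖(α : ℂ)‖ ^ 2 * flatMetric _ X Y := by
  have h : inner ℂ (diagAut α β X) (diagAut α β Y)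
      = ((‖(α : ℂ)‖ ^ 2 : ℝ) : ℂ) * inner ℂ X Y := by
    have h1 : (α : ℂ) * (starRingEnd ℂ) α = ((‖(α : ℂ)‖ ^ 2 : ℝ) : ℂ) := by
      rw [Complex.mul_conj']; norm_cast
    have h2 : (β : ℂ) * (starRingEnd ℂ) β = ((‖(α : ℂ)‖ ^ 2 : ℝ) : ℂ) := by
      rw [Complex.mul_conj', habs]; norm_cast
    simp only [PiLp.inner_apply, Fin.sum_univ_two, RCLike.inner_apply, diagAut]
    simp
    push_cast at h1 h2
    linear_combination (Y 0 * (starRingEnd ℂ) (X 0)) * h1 + (Y 1 * (starRingEnd ℂ) (X 1)) * h2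
  rw [flatMetric_apply, flatMetric_apply, h, Complex.re_ofReal_mul]

theorem isGauduchonOrneaPotential_norm_sq {α β : ℂˣ} (habs : ‖(α : ℂ)‖ = ‖(β : ℂ)‖)
    (hone : ‖(α : ℂ)‖ ≠ 1) : IsGauduchonOrneaPotential α β fun z => ‖z‖ ^ 2 := by
  intro z hz
  have hz' : 0 < ‖z‖ := norm_pos_iff.2 hz
  have hlog : Real.log ‖(α : ℂ)‖ ≠ 0 :=
    Real.log_ne_zero_of_pos_of_ne_one (norm_pos_iff.2 α.ne_zero) hone
  refine ⟨by positivity, ?_⟩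
  have he : 2 * Real.log ‖(α : ℂ)‖ / (Real.log ‖(α : ℂ)‖ + Real.log ‖(α : ℂ)‖) = 1 := by
    field_simp
    norm_num
  have hs : ‖z‖ ^ 2 = ‖z 0‖ ^ 2 + ‖z 1‖ ^ 2 := by
    rw [EuclideanSpace.norm_sq_eq, Fin.sum_univ_two]
  rw [← habs, he, Real.rpow_neg_one, ← add_mul, ← hs]
  exact mul_inv_cancel₀ (by positivity)

end HopfLcK

theorem mainTheorem7 (α β : ℂˣ) (hne : α ≠ β) (habs : ‖(α : ℂ)‖ = ‖(β : ℂ)‖)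
    (hone : ‖(α : ℂ)‖ ≠ 1) :
    (∃ g : HopfLcK.HermitianMetric (HopfLcK.diagAut α β),
      HopfLcK.IsGauduchonOrnea α β g ∧ HopfLcK.IsVaisman g) ∧
    (∀ g : HopfLcK.HermitianMetric (HopfLcK.diagAut α β), HopfLcK.IsVaisman g →
      ∀ k : ℕ∞, ¬ HopfLcK.IsApproximable k g) := by
  refine ⟨⟨HopfLcK.homothetyMetric _ (‖(α : ℂ)‖ ^ 2) (by simp) (HopfLcK.flatMetric_diagAut habs),
    ⟨_, HopfLcK.isGauduchonOrneaPotential_norm_sq habs hone, fun z _ X Y => ?_⟩,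
    HopfLcK.isVaisman_homothetyMetric⟩, ?_⟩
  · rw [HopfLcK.homothetyMetric_apply, HopfLcK.ddcTensor_norm_sq]
  -- There are no Hopf-induced metrics, so an approximating sequence already fails at its first
  -- term.
  · rintro g - k ⟨gs, hgs, -⟩
    exact HopfLcK.not_isHopfInduced hne habs hone (gs 0) (hgs 0)

end
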